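/- Let $\mathbb k$ be a field and let $\mathcal S\subseteq\mathbb N^3$ be a simplicial affine semigroup, i.e. a finitely generated submonoid, with minimal generating set $\mathcal A$, containing $\mathbb Q$-linearly independent vectors $\mathbf a_1,\mathbf a_2,\mathbf a_3\in\mathcal A$ (the extremal rays) that generate the rational cone $\operatorname{pos}(\mathcal A)=\sum_{\mathbf a\in\mathcal A}\mathbb Q_{\ge 0}\mathbf a$, where each $\mathbf a_i$ is the componentwise smallest element of $\mathcal A$ on the ray $\mathbb Q_{\ge0}\mathbf a_i$. For $\mathbf b\in\mathcal S$ put $\operatorname{Ap}(\mathcal S,\mathbf b)=\{\mathbf a\in\mathcal S : \mathbf a-\mathbf b\notin\mathcal S\}$, and let $\mathbf a\preceq_{\mathcal S}\mathbf a'$ mean $\mathbf a'-\mathbf a\in\mathcal S$. Let $\operatorname{depth}(\mathbb k[\mathcal S])$ be the maximum length of a $\mathbb k[\mathcal S]$-regular sequence in the maximal ideal of the semigroup ring $\mathbb k[\mathcal S]$ generated by the monomials $\mathbf t^{\mathbf s}$, $\mathbf s\in\mathcal S\setminus\{\mathbf 0\}$. Then $\operatorname{depth}(\mathbb k[\mathcal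 S])=2$ if and only if both of the following hold: 1. $\operatorname{Ap}(\mathcal S,\mathbf b)$ has no maximal element with respect to $\preceq_{\mathcal S}$ for some $\mathbf b\in\mathcal S\setminus\{\mathbf 0\}$; 2. $\operatorname{Ap}(\mathcal S,\mathbf a_i)\cap\operatorname{Ap}(\mathcal S,\mathbf a_j)$ has a maximal element with respect to $\preceq_{\mathcal S}$ for some $1\le i<j\le 3$. Moreover, condition 1 holds for some $\mathbf b\in\mathcal S\setminus\{\mathbf 0\}$ if and only if it holds for every $\mathbf b\in\mathcal S\setminus\{\mathbf 0\}$. -/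

import Mathlib

namespace AffineSemigroup

/-- The inclusion of `ℕ ^ d` into `ℚ ^ d`. -/
def toRat {d : ℕ} (v : Fin d → ℕ) : Fin d → ℚ := fun i => (v i : ℚ)

/-- `S` is a simplicial affine semigroup in `ℕ ^ d` with minimal generating set `A`, and
`a 0, …, a (d - 1)` are its extremal rays: `d` linearly independent elements of `A` that generate
the rational cone `pos(A)`, each being the componentwise smallest element of `A` on its ray.
(The linear independence forces the group generated by `A` to have rank `d`.) -/
structure IsSimplicial {d : ℕ} (S : AddSubmonoid (Fin d → ℕ)) (A : Finset (Fin d → ℕ))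
    (a : Fin d → (Fin d → ℕ)) : Prop where
  closure_eq : AddSubmonoid.closure (A : Set (Fin d → ℕ)) = S
  minimal : ∀ x ∈ A, x ∉ AddSubmonoid.closure ((A : Set (Fin d → ℕ)) \ {x})
  mem : ∀ i, a i ∈ A
  linearIndependent : LinearIndependent ℚ (fun i => toRat (a i))
  cone_eq : PointedCone.hull ℚ (toRat '' Set.range a) =
    PointedCone.hull ℚ (toRat '' (A : Set (Fin d → ℕ)))
  smallest : ∀ i, ∀ x ∈ A, toRat x ∈ PointedCone.hull ℚ {toRat (a i)} → a i ≤ x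

/-- The relation `x ≼_S y`, that is, `y - x ∈ S` (the difference being taken in `ℤ ^ d`, so that
it lies in `S` exactly when `y = x + s` for some `s ∈ S`). -/
def SLE {d : ℕ} (S : AddSubmonoid (Fin d → ℕ)) (x y : Fin d → ℕ) : Prop :=
  ∃ s ∈ S, y = x + s

/-- The Apéry set `Ap(S, b)`: the elements `x` of `S` with `x - b ∉ S`. -/
def apery {d : ℕ} (S : AddSubmonoid (Fin d → ℕ)) (b : Fin d → ℕ) : Set (Fin d → ℕ) :=
  {x | x ∈ S ∧ ¬ SLE S b x}

/-- The set `X` has a maximal element for `≼_S` (a partial order, as `S` lies in `ℕ ^ d`). -/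
def HasMaximal {d : ℕ} (S : AddSubmonoid (Fin d → ℕ)) (X : Set (Fin d → ℕ)) : Prop :=
  ∃ x ∈ X, ∀ y ∈ X, SLE S x y → y = x

/-- The monomial maximal ideal of the semigroup ring `k[S]`, generated by the monomials `t ^ s`
with `s ∈ S` nonzero. -/
noncomputable def monomialIdeal (k : Type*) [Field k] {d : ℕ} (S : AddSubmonoid (Fin d → ℕ)) :
    Ideal (AddMonoidAlgebra k S) :=
  Ideal.span {f | ∃ s : S, s ≠ 0 ∧ f = AddMonoidAlgebra.single s 1}

/-- The depth of the semigroup ring `k[S]`: the maximum length of a `k[S]`-regular sequence of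
elements of the monomial maximal ideal. -/
noncomputable def depth (k : Type*) [Field k] {d : ℕ} (S : AddSubmonoid (Fin d → ℕ)) : ℕ∞ :=
  sSup {n : ℕ∞ | ∃ rs : List (AddMonoidAlgebra k S),
    RingTheory.Sequence.IsRegular (AddMonoidAlgebra k S) rs ∧
      (∀ r ∈ rs, r ∈ monomialIdeal k S) ∧ n = rs.length}

end AffineSemigroup

/-!
The depth of `k[S]` is compared with two and with three separately.

*Depth at least two.* A maximal element `x` of `Ap(S, b)` is the same as a monomial of `k[S]`
outside the ideal `(t ^ b)` that the maximal ideal multiplies into `(t ^ b)`. If none exists, prime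
avoidance yields an element of the maximal ideal regular modulo `t ^ b`
(`exists_isWeaklyRegular_of_not_hasMaximal`). If `f, g` is a regular sequence in the maximal ideal,
an exchange argument carries a socle element modulo `t ^ b` to one modulo `f`, which is impossible
(`not_hasMaximal_of_isWeaklyRegular`). As the depth does not involve `b`, the absence of maximal
elements does not depend on `b` either.

*Depth at least three.* This is the Cohen–Macaulay property, and it is equivalent to the
combinatorial condition `RaysRegular`: if `v + a i` and `v + a j` lie in `S`, where `i ≠ j`, then so
does `v`. Under this condition the monomials at the three rays form a regular sequence. Conversely,
a regular sequence of length three in the maximal ideal, which is the radical of the ideal of the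
three rays, makes the first Koszul homology of the rays vanish
(`koszulOneVanishes_of_isWeaklyRegular`), and a violation of `RaysRegular` would then descend along
the third ray for ever (`IsSimplicial.exists_eq_add_of_koszulOneVanishes`).

*The second condition.* `RaysRegular` fails exactly when some `Ap(S, a i) ∩ Ap(S, a j)` has a
maximal element (`IsSimplicial.exists_hasMaximal_iff`). Given a violation, there are two different
elements `m, m'` of `S` above no ray and with a relation `m + ∑ p i a i = m' + ∑ q i a i`, where `p`
and `q` have disjoint nonempty supports. Of two disjoint nonempty subsets of three indices one is
a singleton `{r}`, so that, up to symmetry, a multiple of `a r` kills `m` modulo the other two rays;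
since only finitely many elements lie above no ray, a maximal element exists above the last
survivor.
-/

namespace AffineSemigroup

/-! ### Apéry sets and decompositions along the extremal rays -/

section Combinatorics

variable {d : ℕ} {S : AddSubmonoid (Fin d → ℕ)} {A : Finset (Fin d → ℕ)} {a : Fin d → (Fin d → ℕ)}

theorem SLE.add_right {x y z : Fin d → ℕ} (h : SLE S x y) (hz : z ∈ S) : SLE S x (y + z) := by
  obtain ⟨s, hs, rfl⟩ := h
  exact ⟨s + z, S.add_mem hs hz, add_assoc _ _ _⟩

theorem SLE.add_left {x y z : Fin d → ℕ} (h : SLE S x y) (hz : z ∈ S) : SLE S x (z + y) := by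
  rw [add_comm]; exact h.add_right hz

theorem IsSimplicial.mem_semigroup (hS : IsSimplicial S A a) (i : Fin d) : a i ∈ S := by
  rw [← hS.closure_eq]; exact AddSubmonoid.subset_closure (hS.mem i)

theorem IsSimplicial.ray_ne_zero (hS : IsSimplicial S A a) (i : Fin d) : a i ≠ 0 := fun h =>
  hS.linearIndependent.ne_zero i (by ext j; simp [toRat, h])

theorem toRat_sum_smul {ι : Type*} (s : Finset ι) (n : ι → ℕ) (v : ι → Fin d → ℕ) :
    toRat (∑ i ∈ s, n i • v i) = ∑ i ∈ s, (n i : ℚ) • toRat (v i) := by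
  ext j; simp [toRat, Finset.sum_apply]

theorem toRat_injective : Function.Injective (toRat (d := d)) := fun v w h => by
  ext j; exact Nat.cast_injective (R := ℚ) (congrFun h j)

theorem IsSimplicial.sum_smul_injective (hS : IsSimplicial S A a) {n m : Fin d → ℕ}
    (h : ∑ i, n i • a i = ∑ i, m i • a i) : n = m := by
  have h1 := congrArg toRat h
  rw [toRat_sum_smul, toRat_sum_smul] at h1
  ext i
  have h2 := Fintype.linearIndependent_iff.1 hS.linearIndependent (fun i => (n i : ℚ) - m i) (by
    simp only [sub_smul, Finset.sum_sub_distrib, h1, sub_self]) i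
  exact_mod_cast sub_eq_zero.1 h2

theorem IsSimplicial.sle_sum_smul (hS : IsSimplicial S A a) {n : Fin d → ℕ} {i : Fin d}
    (hi : n i ≠ 0) : SLE S (a i) (∑ l, n l • a l) := by
  obtain ⟨k, hk⟩ := Nat.exists_eq_succ_of_ne_zero hi
  rw [← Finset.add_sum_erase _ _ (Finset.mem_univ i), hk, succ_nsmul']
  exact SLE.add_right ⟨_, S.nsmul_mem (hS.mem_semigroup i) k, rfl⟩
    (S.sum_mem fun j _ => S.nsmul_mem (hS.mem_semigroup j) _)

theorem sum_add_single_smul (a : Fin d → Fin d → ℕ) (n : Fin d → ℕ) (i : Fin d) :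
    ∑ l, (n + Pi.single i 1 : Fin d → ℕ) l • a l = ∑ l, n l • a l + a i := by
  simp only [Pi.add_apply, add_smul, Finset.sum_add_distrib]
  rw [Finset.sum_eq_single i (f := fun j => (Pi.single i 1 : Fin d → ℕ) j • a j)]
  · simp only [Pi.single_eq_same, one_smul]
  · intro j _ hj; simp [hj]
  · simp

/-- Clearing denominators in the description of the cone: every element of the semigroup has a
positive multiple which is a natural combination of the extremal rays. -/
theorem IsSimplicial.exists_nsmul_eq (hS : IsSimplicial S A a) {x : Fin d → ℕ} (hx : x ∈ S) :
    ∃ N : ℕ, 0 < N ∧ ∃ c : Fin d → ℕ, N • x = ∑ i, c i • a i := by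
  have h1 : toRat x ∈ PointedCone.hull ℚ (toRat '' (A : Set (Fin d → ℕ))) := by
    rw [← hS.closure_eq] at hx
    induction hx using AddSubmonoid.closure_induction with
    | mem x hx => exact Submodule.subset_span ⟨x, hx, rfl⟩
    | zero =>
      have : toRat (0 : Fin d → ℕ) = 0 := by ext; simp [toRat]
      rw [this]; exact Submodule.zero_mem _
    | add x y _ _ hx hy =>
      have : toRat (x + y) = toRat x + toRat y := by ext; simp [toRat]
      rw [this]; exact Submodule.add_mem _ hx hy
  rw [← hS.cone_eq, ← Set.range_comp] at h1
  obtain ⟨c, hc⟩ := (Submodule.mem_span_range_iff_exists_fun _).1 h1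
  have hden : ∀ i, ∃ m : ℕ, ((c i : ℚ)) * (∏ j, (c j : ℚ).den : ℕ) = m := fun i => by
    obtain ⟨k, hk⟩ := Finset.dvd_prod_of_mem (fun j => (c j : ℚ).den) (Finset.mem_univ i)
    refine ⟨(c i : ℚ).num.toNat * k, ?_⟩
    have h2 : (((c i : ℚ).num.toNat : ℤ)) = (c i : ℚ).num :=
      Int.toNat_of_nonneg (Rat.num_nonneg.2 (c i).2)
    have h3 : (((c i : ℚ).num.toNat : ℚ)) = ((c i : ℚ).num : ℚ) := by exact_mod_cast h2
    rw [hk]; push_cast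
    rw [h3, ← mul_assoc, Rat.mul_den_eq_num]
  choose m hm using hden
  refine ⟨∏ j, (c j : ℚ).den, Finset.prod_pos fun j _ => (c j : ℚ).den_pos, m, ?_⟩
  apply toRat_injective
  rw [toRat_sum_smul]
  have h4 : toRat ((∏ j, (c j : ℚ).den) • x) = ((∏ j, (c j : ℚ).den : ℕ) : ℚ) • toRat x := by
    ext; simp [toRat]
  rw [h4, ← hc, Finset.smul_sum]
  refine Finset.sum_congr rfl fun i _ => ?_
  rw [← hm i, mul_comm, mul_smul]
  rfl

/-- Every nonzero element of the semigroup has a multiple lying above some extremal ray. -/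
theorem IsSimplicial.exists_sle_nsmul (hS : IsSimplicial S A a) {x : Fin d → ℕ} (hx : x ∈ S)
    (hx0 : x ≠ 0) : ∃ N : ℕ, ∃ i, SLE S (a i) (N • x) := by
  obtain ⟨N, hN, c, hc⟩ := hS.exists_nsmul_eq hx
  have : ∃ i, c i ≠ 0 := by
    by_contra! h
    simp only [h, zero_smul, Finset.sum_const_zero] at hc
    rcases smul_eq_zero.1 hc with h | h
    · omega
    · exact hx0 h
  obtain ⟨i, hi⟩ := this
  refine ⟨N, i, ?_⟩
  rw [hc]
  exact hS.sle_sum_smul hi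

theorem sum_pos_of_ne_zero {x : Fin d → ℕ} (hx : x ≠ 0) : 0 < ∑ j, x j := by
  by_contra! h
  exact hx (funext fun j => by simpa using (Finset.sum_eq_zero_iff.1 (Nat.le_zero.1 h)) j)

theorem IsSimplicial.zero_notMem (hS : IsSimplicial S A a) : (0 : Fin d → ℕ) ∉ A := fun h =>
  hS.minimal 0 h (AddSubmonoid.zero_mem _)

/-- The elements lying above no extremal ray are bounded (hence finite in number): in an expression
by generators each generator can only occur a bounded number of times. -/
theorem IsSimplicial.exists_bound (hS : IsSimplicial S A a) :
    ∃ B : ℕ, ∀ x ∈ S, (∀ i, ¬ SLE S (a i) x) → ∑ j, x j ≤ B := by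
  have hA : ∀ v : Fin d → ℕ, ∃ N : ℕ, v ∈ A → ∃ i, SLE S (a i) (N • v) := fun v => by
    by_cases hv : v ∈ A
    · obtain ⟨N, h⟩ := hS.exists_sle_nsmul (x := v)
        (by rw [← hS.closure_eq]; exact AddSubmonoid.subset_closure hv)
        (fun h => hS.zero_notMem (h ▸ hv))
      exact ⟨N, fun _ => h⟩
    · exact ⟨0, fun h => absurd h hv⟩
  choose N hN using hA
  refine ⟨∑ v ∈ A, N v * ∑ j, v j, fun x hx hno => ?_⟩
  rw [← hS.closure_eq, AddSubmonoid.mem_closure_finset] at hx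
  obtain ⟨c, -, hx⟩ := hx
  have hAS : ∀ v ∈ A, v ∈ S := fun v hv => by
    rw [← hS.closure_eq]; exact AddSubmonoid.subset_closure hv
  have hc : ∀ v ∈ A, c v ≤ N v := fun v hv => by
    by_contra! hlt
    obtain ⟨i, hi⟩ := hN v hv
    refine hno i ?_
    obtain ⟨e, he⟩ := Nat.exists_eq_add_of_lt hlt
    rw [← hx, ← Finset.add_sum_erase _ _ hv, he, add_assoc, add_nsmul]
    exact (hi.add_right (S.nsmul_mem (hAS v hv) _)).add_right
      (S.sum_mem fun w hw => S.nsmul_mem (hAS w (Finset.mem_of_mem_erase hw)) _)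
  calc ∑ j, x j = ∑ v ∈ A, c v * ∑ j, v j := by
        rw [← hx]
        simp only [Finset.sum_apply, Pi.smul_apply, smul_eq_mul, Finset.mul_sum]
        exact Finset.sum_comm
    _ ≤ _ := Finset.sum_le_sum fun v hv => Nat.mul_le_mul_right _ (hc v hv)

/-- If the elements of `X` above `w ∈ X` have bounded coordinate sum, then one of largest
coordinate sum among them is `≼_S`-maximal in `X`. -/
theorem exists_maximal_of_bound {X : Set (Fin d → ℕ)} {w : Fin d → ℕ} (hw : w ∈ X) {B : ℕ}
    (hB : ∀ y ∈ X, SLE S w y → ∑ j, y j ≤ B) : HasMaximal S X := by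
  classical
  let P : ℕ → Prop := fun n => ∃ y ∈ X, SLE S w y ∧ ∑ j, y j = n
  have hP : P (∑ j, w j) := ⟨w, hw, ⟨0, S.zero_mem, by simp⟩, rfl⟩
  have hle : ∑ j, w j ≤ B := hB w hw ⟨0, S.zero_mem, by simp⟩
  obtain ⟨y, hy, hwy, hsum⟩ := Nat.findGreatest_spec (P := P) hle hP
  refine ⟨y, hy, fun z hz hyz => ?_⟩
  obtain ⟨s, hs, rfl⟩ := hyz
  by_contra hne
  have hs0 : s ≠ 0 := fun h => hne (by simp [h])
  have hwz := hwy.add_right hs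
  have := Nat.le_findGreatest (P := P) (hB _ hz hwz) ⟨_, hz, hwz, rfl⟩
  rw [← hsum] at this
  simp only [Pi.add_apply, Finset.sum_add_distrib] at this
  have := sum_pos_of_ne_zero hs0
  omega

/-- Each element of `S` is the sum of an element above no extremal ray and of a natural combination
of the extremal rays. -/
theorem IsSimplicial.exists_decomposition (hS : IsSimplicial S A a) {x : Fin d → ℕ} (hx : x ∈ S) :
    ∃ m ∈ S, ∃ n : Fin d → ℕ, x = m + ∑ i, n i • a i ∧ ∀ i, ¬ SLE S (a i) m := by
  induction hk : ∑ j, x j using Nat.strong_induction_on generalizing x with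
  | _ k ih =>
  by_cases h : ∃ i, SLE S (a i) x
  · obtain ⟨i, s, hs, rfl⟩ := h
    have hpos := sum_pos_of_ne_zero (hS.ray_ne_zero i)
    simp only [Pi.add_apply, Finset.sum_add_distrib] at hk
    obtain ⟨m, hm, n, rfl, hno⟩ := ih (∑ j, s j) (by omega) hs rfl
    refine ⟨m, hm, n + Pi.single i 1, ?_, hno⟩
    rw [sum_add_single_smul]
    abel
  · exact ⟨x, hx, 0, by simp, fun i hi => h ⟨i, hi⟩⟩

/-- The combinatorial Cohen–Macaulay condition: if `v + a i` and `v + a j` lie in `S` for some `v`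
in the group of `S` and `i ≠ j`, then `v ∈ S`. Here `s = v + a i` and `t = v + a j`, which avoids
subtraction. -/
def RaysRegular (S : AddSubmonoid (Fin d → ℕ)) (a : Fin d → (Fin d → ℕ)) : Prop :=
  ∀ i j, i ≠ j → ∀ s ∈ S, ∀ t ∈ S, s + a j = t + a i → SLE S (a i) s

theorem mem_apery_inter {b c x : Fin d → ℕ} :
    x ∈ apery S b ∩ apery S c ↔ x ∈ S ∧ ¬ SLE S b x ∧ ¬ SLE S c x := by
  simp only [apery, Set.mem_inter_iff, Set.mem_ofPred_eq]; tauto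

end Combinatorics

/-! ### Maximal elements for pairs of rays in dimension three -/

section Three

variable {S : AddSubmonoid (Fin 3 → ℕ)} {A : Finset (Fin 3 → ℕ)} {a : Fin 3 → (Fin 3 → ℕ)}

theorem eq_or_eq_or_eq {i j r : Fin 3} (hij : i ≠ j) (hir : i ≠ r) (hjr : j ≠ r) (l : Fin 3) :
    l = i ∨ l = j ∨ l = r := by omega

theorem exists_third {i j : Fin 3} (hij : i ≠ j) : ∃ r, i ≠ r ∧ j ≠ r := by
  revert i j; decide

/-- A maximal element `x` would have `x + a r` above one of the two rays, where `r` is the third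
index, and `RaysRegular` removes the summand `a r`. -/
theorem RaysRegular.not_hasMaximal (hS : IsSimplicial S A a) (h : RaysRegular S a) {i j : Fin 3}
    (hij : i ≠ j) : ¬ HasMaximal S (apery S (a i) ∩ apery S (a j)) := by
  rintro ⟨x, hx, hmax⟩
  obtain ⟨hxS, hxi, hxj⟩ := mem_apery_inter.1 hx
  obtain ⟨r, hir, hjr⟩ := exists_third hij
  have h1 : x + a r ∉ apery S (a i) ∩ apery S (a j) := fun hmem =>
    hS.ray_ne_zero r (by simpa using hmax _ hmem ⟨_, hS.mem_semigroup r, rfl⟩)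
  rw [mem_apery_inter] at h1
  have h2 : SLE S (a i) (x + a r) ∨ SLE S (a j) (x + a r) := by
    by_contra! h3
    exact h1 ⟨S.add_mem hxS (hS.mem_semigroup r), h3⟩
  rcases h2 with ⟨s, hs, h2⟩ | ⟨s, hs, h2⟩
  · exact hxi (h i r hir x hxS s hs (by rw [h2, add_comm]))
  · exact hxj (h j r hjr x hxS s hs (by rw [h2, add_comm]))

/-- If multiplication by the third ray kills `w` modulo the other two, then the elements above `w`
which survive modulo the two rays are bounded, so that one of them is maximal. -/
theorem IsSimplicial.hasMaximal_of_torsion (hS : IsSimplicial S A a) {i j r : Fin 3} (hij : i ≠ j)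
    (hir : i ≠ r) (hjr : j ≠ r) {w : Fin 3 → ℕ} (hw : w ∈ S) (hi : ¬ SLE S (a i) w)
    (hj : ¬ SLE S (a j) w) (hr : SLE S (a i) (w + a r) ∨ SLE S (a j) (w + a r)) :
    HasMaximal S (apery S (a i) ∩ apery S (a j)) := by
  obtain ⟨B, hB⟩ := hS.exists_bound
  refine exists_maximal_of_bound (S := S) (w := w) (mem_apery_inter.2 ⟨hw, hi, hj⟩)
    (B := ∑ l, w l + B) ?_
  rintro _ hy ⟨s, hs, rfl⟩
  obtain ⟨-, hyi, hyj⟩ := mem_apery_inter.1 hy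
  simp only [Pi.add_apply, Finset.sum_add_distrib]
  refine Nat.add_le_add_left (hB s hs fun l hl => ?_) _
  rcases eq_or_eq_or_eq hij hir hjr l with rfl | rfl | rfl
  · exact hyi (hl.add_left hw)
  · exact hyj (hl.add_left hw)
  · obtain ⟨s, hs', rfl⟩ := hl
    rw [← add_assoc] at hyi hyj
    rcases hr with hr | hr
    · exact hyi (hr.add_right hs')
    · exact hyj (hr.add_right hs')

/-- A relation `m + k a r = m' + (a nonzero combination of the other two rays)` makes a multiple of
`a r` kill `m` modulo the other two rays; the last survivor among the `m + n a r` is then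
killed by `a r` itself. -/
theorem IsSimplicial.hasMaximal_of_relation (hS : IsSimplicial S A a) {m m' : Fin 3 → ℕ}
    (hm : m ∈ S) (hm' : m' ∈ S) (hno : ∀ i, ¬ SLE S (a i) m) {r : Fin 3} {p q : Fin 3 → ℕ}
    (h : m + ∑ i, p i • a i = m' + ∑ i, q i • a i) (hp : ∀ i, i ≠ r → p i = 0) (hqr : q r = 0)
    (hq : q ≠ 0) :
    ∃ i j : Fin 3, i ≠ j ∧ HasMaximal S (apery S (a i) ∩ apery S (a j)) := by
  classical
  obtain ⟨i, hi⟩ : ∃ i, q i ≠ 0 := by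
    by_contra! h0; exact hq (funext h0)
  have hir : i ≠ r := fun h => hi (h ▸ hqr)
  obtain ⟨j, hij, hrj⟩ := exists_third hir
  have h1 : ∑ l, p l • a l = p r • a r :=
    Finset.sum_eq_single r (fun l _ hl => by rw [hp l hl, zero_smul]) (by simp)
  rw [h1] at h
  let P : ℕ → Prop := fun n => SLE S (a i) (m + n • a r) ∨ SLE S (a j) (m + n • a r)
  have hP : P (p r) := by
    left
    rw [h]
    exact (hS.sle_sum_smul hi).add_left hm'
  have hP0 : ¬ P 0 := by simp [P, hno]
  have hex : ∃ n, P n := ⟨_, hP⟩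
  obtain ⟨n, hn⟩ := Nat.exists_eq_succ_of_ne_zero (n := Nat.find hex)
    (fun h0 => hP0 (h0 ▸ Nat.find_spec hex))
  have h2 : ¬ P n := Nat.find_min hex (by omega)
  have h3 : P (n + 1) := by have := Nat.find_spec hex; rwa [hn] at this
  simp only [P, not_or] at h2
  refine ⟨i, j, hij, hS.hasMaximal_of_torsion hij hir hrj.symm
    (S.add_mem hm (S.nsmul_mem (hS.mem_semigroup r) n)) h2.1 h2.2 ?_⟩
  simpa only [P, succ_nsmul, add_assoc] using h3

/-- Write two offending elements as `m + ∑ n i • a i` and `m' + ∑ n' i • a i` with `m ≠ m'` above no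
ray. After cancellation the two combinations have disjoint nonempty supports, and of two disjoint
nonempty subsets of a set of three elements one is a singleton. -/
theorem IsSimplicial.exists_hasMaximal_of_not_raysRegular (hS : IsSimplicial S A a)
    (h : ¬ RaysRegular S a) :
    ∃ i j : Fin 3, i ≠ j ∧ HasMaximal S (apery S (a i) ∩ apery S (a j)) := by
  unfold RaysRegular at h
  push Not at h
  obtain ⟨i, j, hij, s, hs, t, ht, hst, hno⟩ := h
  obtain ⟨m, hm, n, rfl, hmno⟩ := hS.exists_decomposition hs
  obtain ⟨m', hm', n', rfl, hmno'⟩ := hS.exists_decomposition ht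
  rw [add_assoc, add_assoc, ← sum_add_single_smul, ← sum_add_single_smul] at hst
  -- Otherwise the independence of the rays shows that `a i` occurs in `s`.
  have hne : m ≠ m' := by
    rintro rfl
    have h1 := congrFun (hS.sum_smul_injective (add_left_cancel hst)) i
    simp only [Pi.add_apply, Pi.single_eq_same, Pi.single_eq_of_ne hij] at h1
    exact hno ((hS.sle_sum_smul (i := i) (by omega)).add_left hm)
  set N : Fin 3 → ℕ := n + Pi.single j 1
  set N' : Fin 3 → ℕ := n' + Pi.single i 1
  let p : Fin 3 → ℕ := fun l => N l - N' l
  let q : Fin 3 → ℕ := fun l => N' l - N l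
  have hpq : m + ∑ l, p l • a l = m' + ∑ l, q l • a l := by
    have e1 : ∑ l, N l • a l = ∑ l, p l • a l + ∑ l, (min (N l) (N' l)) • a l := by
      rw [← Finset.sum_add_distrib]
      refine Finset.sum_congr rfl fun l _ => ?_
      rw [← add_smul]; congr 1; simp only [p]; omega
    have e2 : ∑ l, N' l • a l = ∑ l, q l • a l + ∑ l, (min (N l) (N' l)) • a l := by
      rw [← Finset.sum_add_distrib]
      refine Finset.sum_congr rfl fun l _ => ?_
      rw [← add_smul]; congr 1; simp only [q]; omega
    rw [e1, e2, ← add_assoc, ← add_assoc] at hst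
    exact add_right_cancel hst
  have key : ∀ {m m' : Fin 3 → ℕ} {p q : Fin 3 → ℕ}, m' ∈ S → (∀ i, ¬ SLE S (a i) m) → m ≠ m' →
      m + ∑ l, p l • a l = m' + ∑ l, q l • a l → p = 0 → False := by
    rintro m m' p q hm' hmno hne h rfl
    simp only [Pi.zero_apply, zero_smul, Finset.sum_const_zero, add_zero] at h
    by_cases hq : ∃ i, q i ≠ 0
    · obtain ⟨i, hi⟩ := hq
      exact hmno i (h ▸ (hS.sle_sum_smul hi).add_left hm')
    · push Not at hq
      simp [hq] at h
      exact hne h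
  have hp0 : p ≠ 0 := key hm' hmno hne hpq
  have hq0 : q ≠ 0 := key hm hmno' hne.symm hpq.symm
  have hdisj : ∀ l, p l = 0 ∨ q l = 0 := fun l => by simp only [p, q]; omega
  -- Two disjoint nonempty subsets of `Fin 3`: one of them is a singleton `{r}`.
  have hsingle : ∃ r, ((∀ l, l ≠ r → p l = 0) ∧ q r = 0) ∨ ((∀ l, l ≠ r → q l = 0) ∧ p r = 0) := by
    have hp1 : ∃ l, p l ≠ 0 := by by_contra! h0; exact hp0 (funext h0)
    have hq1 : ∃ l, q l ≠ 0 := by by_contra! h0; exact hq0 (funext h0)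
    clear_value p q
    simp only [Fin.exists_fin_succ, Fin.forall_fin_succ] at *
    simp at *
    grind
  obtain ⟨r, ⟨h1, h2⟩ | ⟨h1, h2⟩⟩ := hsingle
  · exact hS.hasMaximal_of_relation hm hm' hmno hpq h1 h2 hq0
  · exact hS.hasMaximal_of_relation hm' hm hmno' hpq.symm h1 h2 hp0

/-- Some `Ap(S, a i) ∩ Ap(S, a j)` has a maximal element exactly when the semigroup ring is not
Cohen–Macaulay, in the combinatorial form `RaysRegular`. -/
theorem IsSimplicial.exists_hasMaximal_iff (hS : IsSimplicial S A a) :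
    (∃ i j : Fin 3, i < j ∧ HasMaximal S (apery S (a i) ∩ apery S (a j))) ↔ ¬ RaysRegular S a := by
  constructor
  · rintro ⟨i, j, hij, h⟩ hreg
    exact hreg.not_hasMaximal hS hij.ne h
  · intro h
    obtain ⟨i, j, hij, h⟩ := hS.exists_hasMaximal_of_not_raysRegular h
    rcases hij.lt_or_gt with hlt | hlt
    · exact ⟨i, j, hlt, h⟩
    · exact ⟨j, i, hlt, by rwa [Set.inter_comm]⟩

end Three


/-! ### The Koszul complex of three elements -/

section Koszul

variable {R : Type*} [CommRing R] (x y z : R) (M : Type*) [AddCommGroup M] [Module R M]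

/-- Vanishing of the third homology of the Koszul complex of `x, y, z` on `M`. -/
def KoszulThreeVanishes : Prop :=
  ∀ u : M, x • u = 0 → y • u = 0 → z • u = 0 → u = 0

/-- Vanishing of the second homology of the Koszul complex of `x, y, z` on `M`. The chain
`(p, q, r)` stands for `p e₁₂ + q e₁₃ + r e₂₃`. -/
def KoszulTwoVanishes : Prop :=
  ∀ p q r : M, x • p = z • r → y • p = -(z • q) → x • q = -(y • r) →
    ∃ u : M, p = z • u ∧ q = -(y • u) ∧ r = x • u

/-- Vanishing of the first homology of the Koszul complex of `x, y, z` on `M`. -/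
def KoszulOneVanishes : Prop :=
  ∀ a b c : M, x • a + y • b + z • c = 0 →
    ∃ p q r : M, a = -(y • p) - z • q ∧ b = x • p - z • r ∧ c = x • q + y • r

variable {x y z M} {f : R}

theorem quotSMulTop_mk_eq_zero {u : M} :
    (Submodule.Quotient.mk u : QuotSMulTop f M) = 0 ↔ ∃ v, u = f • v := by
  rw [Submodule.Quotient.mk_eq_zero, Submodule.mem_smul_pointwise_iff_exists]
  simp [eq_comm]

theorem mem_span_triple {e : R} :
    e ∈ Ideal.span {x, y, z} ↔ ∃ α β γ, e = α * x + β * y + γ * z := by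
  rw [Submodule.mem_span_triple]
  simp [eq_comm]

theorem koszulThreeVanishes_of_regular (hf : IsSMulRegular M f)
    (hrad : f ∈ (Ideal.span {x, y, z}).radical) : KoszulThreeVanishes x y z M := by
  intro u hx hy hz
  obtain ⟨N, hN⟩ := hrad
  obtain ⟨α, β, γ, h⟩ := mem_span_triple.1 hN
  refine (hf.pow N).right_eq_zero_of_smul ?_
  rw [h]
  linear_combination (norm := module) α • hx + β • hy + γ • hz

/-- The long exact Koszul sequence of `0 → M → M → M / f M → 0` shows that `f` acts injectively on
the second homology of `M`; it also acts nilpotently, as `x, y, z` kill the homology. -/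
theorem koszulTwoVanishes_of_regular (hf : IsSMulRegular M f)
    (hrad : f ∈ (Ideal.span {x, y, z}).radical)
    (h3 : KoszulThreeVanishes x y z (QuotSMulTop f M)) : KoszulTwoVanishes x y z M := by
  -- `f` acts injectively on the homology.
  have step : ∀ p q r u : M, f • p = z • u → f • q = -(y • u) → f • r = x • u →
      ∃ u : M, p = z • u ∧ q = -(y • u) ∧ r = x • u := by
    intro p q r u hp hq hr
    have hu : (Submodule.Quotient.mk u : QuotSMulTop f M) = 0 := by
      refine h3 _ ?_ ?_ ?_ <;> rw [← Submodule.Quotient.mk_smul, quotSMulTop_mk_eq_zero]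
      · exact ⟨r, hr.symm⟩
      · exact ⟨-q, by rw [smul_neg, hq, neg_neg]⟩
      · exact ⟨p, hp.symm⟩
    obtain ⟨v, rfl⟩ := quotSMulTop_mk_eq_zero.1 hu
    refine ⟨v, hf ?_, hf ?_, hf ?_⟩
    · simp only [hp, smul_comm z f]
    · simp only [hq, smul_comm y f, smul_neg]
    · simp only [hr, smul_comm x f]
  have pow : ∀ (N : ℕ) (p q r u : M),
      f ^ N • p = z • u → f ^ N • q = -(y • u) → f ^ N • r = x • u →
      ∃ u : M, p = z • u ∧ q = -(y • u) ∧ r = x • u := by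
    intro N
    induction N with
    | zero =>
      intro p q r u hp hq hr
      exact ⟨u, by simpa using hp, by simpa using hq, by simpa using hr⟩
    | succ N ih =>
      intro p q r u hp hq hr
      simp only [pow_succ, mul_smul] at hp hq hr
      obtain ⟨v, h1, h2, h3⟩ := ih _ _ _ u hp hq hr
      exact step p q r v h1 h2 h3
  intro p q r h1 h2 h3
  obtain ⟨N, hN⟩ := hrad
  obtain ⟨α, β, γ, h⟩ := mem_span_triple.1 hN
  refine pow N p q r (α • r - β • q + γ • p) ?_ ?_ ?_ <;> rw [h]
  · linear_combination (norm := module) α • h1 + β • h2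
  · linear_combination (norm := module) α • h3 + γ • h2
  · linear_combination (norm := module) β • h3 - γ • h1

/-- The same argument one degree lower. -/
theorem koszulOneVanishes_of_regular (hf : IsSMulRegular M f)
    (hrad : f ∈ (Ideal.span {x, y, z}).radical)
    (h2 : KoszulTwoVanishes x y z (QuotSMulTop f M)) : KoszulOneVanishes x y z M := by
  -- `f` acts injectively on the homology.
  have step : ∀ a b c p q r : M,
      f • a = -(y • p) - z • q → f • b = x • p - z • r → f • c = x • q + y • r →
      x • a + y • b + z • c = 0 →
      ∃ p q r : M, a = -(y • p) - z • q ∧ b = x • p - z • r ∧ c = x • q + y • r := by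
    intro a b c p q r ha hb hc hcyc
    obtain ⟨u, hp, hq, hr⟩ := h2 (Submodule.Quotient.mk p) (Submodule.Quotient.mk q)
      (Submodule.Quotient.mk r)
      (by
        rw [← sub_eq_zero]
        exact quotSMulTop_mk_eq_zero.2 ⟨b, hb.symm⟩)
      (by
        rw [← sub_eq_zero]
        exact quotSMulTop_mk_eq_zero.2 ⟨-a, show y • p - -(z • q) = f • -a by
          linear_combination (norm := module) ha⟩)
      (by
        rw [← sub_eq_zero]
        exact quotSMulTop_mk_eq_zero.2 ⟨c, show x • q - -(y • r) = f • c by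
          linear_combination (norm := module) -hc⟩)
    obtain ⟨u, rfl⟩ := Submodule.Quotient.mk_surjective _ u
    obtain ⟨p', hp'⟩ := quotSMulTop_mk_eq_zero.1 (sub_eq_zero.2 hp)
    obtain ⟨q', hq'⟩ := quotSMulTop_mk_eq_zero.1 (sub_eq_zero.2 hq)
    obtain ⟨r', hr'⟩ := quotSMulTop_mk_eq_zero.1 (sub_eq_zero.2 hr)
    refine ⟨p', q', r', hf ?_, hf ?_, hf ?_⟩ <;> dsimp only
    · linear_combination (norm := module) ha - y • hp' - z • hq'
    · linear_combination (norm := module) hb + x • hp' - z • hr'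
    · linear_combination (norm := module) hc + x • hq' + y • hr'
  have pow : ∀ (N : ℕ) (a b c p q r : M), f ^ N • a = -(y • p) - z • q →
      f ^ N • b = x • p - z • r → f ^ N • c = x • q + y • r → x • a + y • b + z • c = 0 →
      ∃ p q r : M, a = -(y • p) - z • q ∧ b = x • p - z • r ∧ c = x • q + y • r := by
    intro N
    induction N with
    | zero =>
      intro a b c p q r ha hb hc _
      exact ⟨p, q, r, by simpa using ha, by simpa using hb, by simpa using hc⟩
    | succ N ih =>
      intro a b c p q r ha hb hc hcyc
      simp only [pow_succ, mul_smul] at ha hb hc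
      obtain ⟨p', q', r', h1, h2, h3⟩ := ih _ _ _ p q r ha hb hc
        (by linear_combination (norm := module) f • hcyc)
      exact step a b c p' q' r' h1 h2 h3 hcyc
  intro a b c hcyc
  obtain ⟨N, hN⟩ := hrad
  obtain ⟨α, β, γ, h⟩ := mem_span_triple.1 hN
  refine pow N a b c (α • b - β • a) (α • c - γ • a) (β • c - γ • b) ?_ ?_ ?_ hcyc <;> rw [h]
  · linear_combination (norm := module) α • hcyc
  · linear_combination (norm := module) β • hcyc
  · linear_combination (norm := module) γ • hcyc

/-- Depth sensitivity of the Koszul complex, in the case of three elements. -/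
theorem koszulOneVanishes_of_isWeaklyRegular {f g h : R} {rs : List R}
    (hreg : RingTheory.Sequence.IsWeaklyRegular M (f :: g :: h :: rs))
    (hf : f ∈ (Ideal.span {x, y, z}).radical) (hg : g ∈ (Ideal.span {x, y, z}).radical)
    (hh : h ∈ (Ideal.span {x, y, z}).radical) : KoszulOneVanishes x y z M := by
  simp only [RingTheory.Sequence.isWeaklyRegular_cons_iff] at hreg
  obtain ⟨h1, h2, h3, -⟩ := hreg
  exact koszulOneVanishes_of_regular h1 hf
    (koszulTwoVanishes_of_regular h2 hg (koszulThreeVanishes_of_regular h3 hh))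

end Koszul

/-! ### Monomials and monomial ideals -/

section Monomials

variable {k : Type*} [Field k] {G : Type*} [AddCommMonoid G]

open AddMonoidAlgebra

theorem coeff_single_mul_add [IsCancelAdd G] (g h : G) (x : AddMonoidAlgebra k G) :
    (single g 1 * x).coeff (g + h) = x.coeff h := by
  rw [coeff_single_mul_eq_mul_coeff h (by simp), one_mul]

theorem coeff_single_mul_eq_zero {g h : G} (x : AddMonoidAlgebra k G) (hg : ¬ ∃ d, h = g + d) :
    (single g 1 * x).coeff h = 0 :=
  coeff_single_mul_of_forall_add_ne _ _ fun d hd => hg ⟨d, hd.symm⟩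

theorem single_mul_cancel [IsCancelAdd G] {g : G} {x y : AddMonoidAlgebra k G}
    (h : single g 1 * x = single g 1 * y) : x = y := by
  ext l
  rw [← coeff_single_mul_add g, h, coeff_single_mul_add]

/-- Membership in a monomial ideal is decided on the support. -/
theorem mem_span_single_iff {T : Set G} {x : AddMonoidAlgebra k G} :
    x ∈ Ideal.span ((fun g => single g (1 : k)) '' T) ↔
      ∀ m, x.coeff m ≠ 0 → ∃ g ∈ T, ∃ d, m = g + d := by
  refine mem_ideal_span_of'_image.trans ?_
  simp only [Finsupp.mem_support_iff, add_comm]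

end Monomials

/-! ### Depth at least two and socle elements -/

section Depth

open AddMonoidAlgebra RingTheory.Sequence

variable {k : Type*} [Field k] {d : ℕ} {S : AddSubmonoid (Fin d → ℕ)}

theorem sle_iff {b x : S} : SLE S (b : Fin d → ℕ) x ↔ ∃ s : S, x = b + s :=
  ⟨fun ⟨s, hs, h⟩ => ⟨⟨s, hs⟩, Subtype.ext h⟩, fun ⟨s, h⟩ => ⟨s, s.2, congrArg Subtype.val h⟩⟩

theorem single_mem_monomialIdeal {s : S} (hs : s ≠ 0) :
    (single s 1 : AddMonoidAlgebra k S) ∈ monomialIdeal k S :=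
  Ideal.subset_span ⟨s, hs, rfl⟩

theorem coeff_zero_of_mem_monomialIdeal {x : AddMonoidAlgebra k S} (hx : x ∈ monomialIdeal k S) :
    x.coeff 0 = 0 := by
  have hset : {f : AddMonoidAlgebra k S | ∃ s : S, s ≠ 0 ∧ f = single s 1} =
      (fun g => single g (1 : k)) '' {s : S | s ≠ 0} := by
    ext f; simp [eq_comm]
  rw [monomialIdeal, hset, mem_span_single_iff] at hx
  by_contra h
  obtain ⟨g, hg, e, he⟩ := hx 0 h
  refine hg (Subtype.ext (funext fun j => ?_))
  have := congrFun (congrArg Subtype.val he) j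
  simp only [ZeroMemClass.coe_zero, Pi.zero_apply, AddSubmonoid.coe_add, Pi.add_apply] at this ⊢
  omega

/-- In the maximal ideal every weakly regular sequence is regular, as the ideal it generates is
proper. -/
theorem isRegular_of_isWeaklyRegular {rs : List (AddMonoidAlgebra k S)}
    (h : IsWeaklyRegular (AddMonoidAlgebra k S) rs) (hm : ∀ r ∈ rs, r ∈ monomialIdeal k S) :
    IsRegular (AddMonoidAlgebra k S) rs := by
  refine ⟨h, fun htop => ?_⟩
  have h1 : (1 : AddMonoidAlgebra k S) ∈ Ideal.ofList rs := by
    have : (1 : AddMonoidAlgebra k S) ∈ Ideal.ofList rs • (⊤ : Ideal (AddMonoidAlgebra k S)) := by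
      rw [← htop]; trivial
    simpa using this
  have h2 : Ideal.ofList rs ≤ monomialIdeal k S := Ideal.span_le.2 hm
  simpa using coeff_zero_of_mem_monomialIdeal (h2 h1)

theorem le_depth {rs : List (AddMonoidAlgebra k S)}
    (h : IsWeaklyRegular (AddMonoidAlgebra k S) rs) (hm : ∀ r ∈ rs, r ∈ monomialIdeal k S) :
    (rs.length : ℕ∞) ≤ depth k S :=
  le_sSup ⟨rs, isRegular_of_isWeaklyRegular h hm, hm, rfl⟩

theorem single_isSMulRegular (s : S) :
    IsSMulRegular (AddMonoidAlgebra k S) (single s 1 : AddMonoidAlgebra k S) :=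
  fun _ _ h => single_mul_cancel h

/-- A maximal element `x` of `Ap(S, b)` gives a socle element of `k[S] / (t ^ b)`. -/
theorem socle_of_maximal {b x : S}
    (hmax : ∀ y ∈ apery S (b : Fin d → ℕ), SLE S x y → y = x) {e : AddMonoidAlgebra k S}
    (he : e ∈ monomialIdeal k S) :
    ∃ u, e * single x 1 = single b 1 * u := by
  change e ∈ Submodule.span _ _ at he
  induction he using Submodule.span_induction with
  | mem e he =>
    obtain ⟨s, hs, rfl⟩ := he
    have h1 : SLE S (b : Fin d → ℕ) (x + s : S) := by
      by_contra h
      have h2 := hmax _ ⟨(x + s).2, h⟩ ⟨s, s.2, rfl⟩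
      exact hs (Subtype.ext (by simpa using h2))
    obtain ⟨u, hu⟩ := sle_iff.1 h1
    exact ⟨single u 1, by rw [single_mul_single, single_mul_single, add_comm s, hu]⟩
  | zero => exact ⟨0, by simp⟩
  | add e e' _ _ h h' =>
    obtain ⟨u, hu⟩ := h
    obtain ⟨u', hu'⟩ := h'
    exact ⟨u + u', by rw [add_mul, hu, hu', mul_add]⟩
  | smul c e _ h =>
    obtain ⟨u, hu⟩ := h
    exact ⟨c * u, by rw [smul_eq_mul, mul_assoc, hu]; ring⟩

/-- If `f, g` is a regular sequence in the maximal ideal, then a socle element of `k[S] / (t ^ b)`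
would transfer to one of `k[S] / (f)`, on which `g` is regular. -/
theorem not_hasMaximal_of_isWeaklyRegular {f g : AddMonoidAlgebra k S}
    {rs : List (AddMonoidAlgebra k S)} (h : IsWeaklyRegular (AddMonoidAlgebra k S) (f :: g :: rs))
    (hf : f ∈ monomialIdeal k S) (hg : g ∈ monomialIdeal k S) {b : Fin d → ℕ} (hb : b ∈ S) :
    ¬ HasMaximal S (apery S b) := by
  rintro ⟨x, ⟨hx, hxb⟩, hmax⟩
  lift b to S using hb
  lift x to S using hx
  simp only [isWeaklyRegular_cons_iff] at h
  obtain ⟨h1, h2, -⟩ := h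
  obtain ⟨u, hu⟩ := socle_of_maximal (k := k) hmax hf
  obtain ⟨v, hv⟩ := socle_of_maximal (k := k) hmax hg
  -- `t ^ b` divides both sides of `g (f x) = f (g x)` and cancels.
  have huv : g * u = f * v := by
    apply single_mul_cancel (g := b)
    linear_combination f * hv - g * hu
  have hmk : (Submodule.Quotient.mk u : QuotSMulTop f (AddMonoidAlgebra k S)) = 0 :=
    h2.right_eq_zero_of_smul (by
      rw [← Submodule.Quotient.mk_smul]
      exact quotSMulTop_mk_eq_zero.2 ⟨v, huv⟩)
  obtain ⟨w, rfl⟩ := quotSMulTop_mk_eq_zero.1 hmk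
  have hw : single x 1 = single b 1 * w := h1 (by
    simp only [smul_eq_mul] at hu ⊢
    rw [hu]; ring)
  have h0 := coeff_single_mul_eq_zero w fun hd => hxb (sle_iff.2 hd)
  rw [← hw] at h0
  simp at h0

/-- By prime avoidance, if the maximal ideal kills no nonzero element of `k[S] / (t ^ b)`, then it
contains an element regular on this quotient; and as the ideals involved are monomial, a
nonzero element killed by the maximal ideal can be taken to be a monomial, which is a maximal
element of `Ap(S, b)`. -/
theorem exists_isWeaklyRegular_of_not_hasMaximal [AddMonoid.FG S] {b : Fin d → ℕ} (hb : b ∈ S)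
    (h : ¬ HasMaximal S (apery S b)) :
    ∃ g ∈ monomialIdeal k S, IsWeaklyRegular (AddMonoidAlgebra k S)
      [(single ⟨b, hb⟩ 1 : AddMonoidAlgebra k S), g] := by
  have : IsNoetherianRing (AddMonoidAlgebra k S) :=
    Algebra.FiniteType.isNoetherianRing k (AddMonoidAlgebra k S)
  lift b to S using hb
  by_contra! hno
  let M := QuotSMulTop (single b 1 : AddMonoidAlgebra k S) (AddMonoidAlgebra k S)
  have hzd : (monomialIdeal k S : Set (AddMonoidAlgebra k S)) ⊆
      ⋃ p ∈ associatedPrimes (AddMonoidAlgebra k S) M, p := by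
    rw [biUnion_associatedPrimes_eq_compl_regular]
    intro g hg hreg
    refine hno g hg ?_
    simp only [isWeaklyRegular_cons_iff]
    exact ⟨single_isSMulRegular b, hreg, IsWeaklyRegular.nil _ _⟩
  obtain ⟨P, hP, hle⟩ := (Ideal.subset_union_prime_finite (associatedPrimes.finite _ M)
    (f := id) 0 0 fun _ h _ _ => h.1).1 hzd
  rw [AssociatedPrimes.mem_iff, isAssociatedPrime_iff] at hP
  obtain ⟨hprime, u, hu⟩ := hP
  obtain ⟨u, rfl⟩ := Submodule.Quotient.mk_surjective _ u
  have hkill : ∀ e ∈ monomialIdeal k S, ∃ v, e * u = single b 1 * v := fun e he => by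
    have h1 : e ∈ P := hle he
    rw [hu, Submodule.mem_colon_singleton, Submodule.mem_bot, ← Submodule.Quotient.mk_smul] at h1
    exact quotSMulTop_mk_eq_zero.1 h1
  have hsupp : ∃ s : S, u.coeff s ≠ 0 ∧ ¬ ∃ t, s = b + t := by
    by_contra! hall
    have hmem : u ∈ Ideal.span ((fun g => single g (1 : k)) '' {b}) :=
      mem_span_single_iff.2 fun m hm => ⟨b, rfl, hall m hm⟩
    rw [Set.image_singleton, Ideal.mem_span_singleton] at hmem
    refine hprime.ne_top (Ideal.eq_top_iff_one _ |>.2 ?_)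
    rw [hu, Submodule.mem_colon_singleton, Submodule.mem_bot, one_smul]
    exact quotSMulTop_mk_eq_zero.2 hmem
  obtain ⟨s, hs, hsb⟩ := hsupp
  refine h ⟨s, ⟨s.2, fun hd => hsb (sle_iff.1 hd)⟩, ?_⟩
  rintro _ ⟨-, hy⟩ ⟨t, ht, rfl⟩
  lift t to S using ht
  by_contra hne
  have ht0 : t ≠ 0 := by rintro rfl; simp at hne
  obtain ⟨v, hv⟩ := hkill _ (single_mem_monomialIdeal ht0)
  have h1 := coeff_single_mul_add t s u
  rw [hv, coeff_single_mul_eq_zero] at h1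
  · exact hs h1.symm
  · rintro ⟨c, hc⟩
    exact hy (sle_iff (x := s + t) |>.2 ⟨c, by rw [add_comm, hc]⟩)

/-- A monomial ideal generated by the monomials at `T` is preserved under division by the monomial
at `g` as soon as this holds for monomials. -/
theorem mem_span_single_of_single_mul_mem {T : Set S} {g : S}
    (h : ∀ s, (∃ t ∈ T, ∃ e, g + s = t + e) → ∃ t ∈ T, ∃ e, s = t + e) {x : AddMonoidAlgebra k S}
    (hx : single g 1 * x ∈ Ideal.span ((fun g => single g (1 : k)) '' T)) :
    x ∈ Ideal.span ((fun g => single g (1 : k)) '' T) := by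
  rw [mem_span_single_iff] at hx ⊢
  exact fun s hs => h s (hx (g + s) (by rwa [coeff_single_mul_add]))

end Depth

/-! ### Depth of the ring of a simplicial semigroup in dimension three -/

section Three

open AddMonoidAlgebra RingTheory.Sequence

variable {k : Type*} [Field k] {S : AddSubmonoid (Fin 3 → ℕ)} {A : Finset (Fin 3 → ℕ)}
  {a : Fin 3 → (Fin 3 → ℕ)}

/-- The extremal rays as elements of the semigroup. -/
def IsSimplicial.ray (hS : IsSimplicial S A a) (i : Fin 3) : S := ⟨a i, hS.mem_semigroup i⟩

theorem RaysRegular.exists_eq_add (hS : IsSimplicial S A a) (h : RaysRegular S a) {i j : Fin 3}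
    (hij : i ≠ j) {s t : S} (hst : hS.ray j + s = hS.ray i + t) : ∃ e, s = hS.ray i + e := by
  refine sle_iff.1 (h i j hij s s.2 t t.2 ?_)
  have := congrArg Subtype.val hst
  rw [add_comm, add_comm (t : Fin 3 → ℕ)]
  exact this

/-- Under `RaysRegular` the monomials at the rays form a regular sequence: the quotients are by
monomial ideals, so this only has to be tested on monomials. -/
theorem RaysRegular.isWeaklyRegular (hS : IsSimplicial S A a) (h : RaysRegular S a) :
    IsWeaklyRegular (AddMonoidAlgebra k S)
      [(single (hS.ray 0) 1 : AddMonoidAlgebra k S), single (hS.ray 1) 1,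
        single (hS.ray 2) 1] := by
  simp only [isWeaklyRegular_cons_iff]
  refine ⟨single_isSMulRegular _, ?_, ?_, IsWeaklyRegular.nil _ _⟩
  · refine .of_right_eq_zero_of_smul fun u hu => ?_
    obtain ⟨u, rfl⟩ := Submodule.Quotient.mk_surjective _ u
    rw [← Submodule.Quotient.mk_smul] at hu
    have h1 := mem_span_single_of_single_mul_mem (k := k) (T := {hS.ray 0}) (g := hS.ray 1)
      (x := u) (by
        rintro s ⟨_, rfl, e, he⟩
        exact ⟨_, rfl, h.exists_eq_add hS (by decide) he⟩)
      (by
        rw [Set.image_singleton, Ideal.mem_span_singleton]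
        exact quotSMulTop_mk_eq_zero.1 hu)
    rw [Set.image_singleton, Ideal.mem_span_singleton] at h1
    exact quotSMulTop_mk_eq_zero.2 h1
  · refine .of_right_eq_zero_of_smul fun u hu => ?_
    obtain ⟨u, rfl⟩ := Submodule.Quotient.mk_surjective _ u
    obtain ⟨u, rfl⟩ := Submodule.Quotient.mk_surjective _ u
    rw [← Submodule.Quotient.mk_smul, ← Submodule.Quotient.mk_smul] at hu
    obtain ⟨v, hv⟩ := quotSMulTop_mk_eq_zero.1 hu
    obtain ⟨v, rfl⟩ := Submodule.Quotient.mk_surjective _ v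
    rw [← Submodule.Quotient.mk_smul, ← sub_eq_zero, ← Submodule.Quotient.mk_sub] at hv
    obtain ⟨w, hw⟩ := quotSMulTop_mk_eq_zero.1 hv
    have h1 := mem_span_single_of_single_mul_mem (k := k) (T := {hS.ray 0, hS.ray 1})
      (g := hS.ray 2) (x := u) (by
        rintro s ⟨_, rfl | rfl, e, he⟩
        · exact ⟨_, .inl rfl, h.exists_eq_add hS (by decide) he⟩
        · exact ⟨_, .inr rfl, h.exists_eq_add hS (by decide) he⟩)
      (by
        rw [Set.image_pair, Ideal.mem_span_pair]
        exact ⟨w, v, by simp only [smul_eq_mul] at hw; linear_combination -hw⟩)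
    rw [Set.image_pair, Ideal.mem_span_pair] at h1
    obtain ⟨p, q, rfl⟩ := h1
    refine quotSMulTop_mk_eq_zero.2 ⟨Submodule.Quotient.mk q, ?_⟩
    rw [← Submodule.Quotient.mk_smul, ← sub_eq_zero, ← Submodule.Quotient.mk_sub]
    exact quotSMulTop_mk_eq_zero.2 ⟨p, by simp only [smul_eq_mul]; ring⟩

theorem IsSimplicial.ray_ne_zero' (hS : IsSimplicial S A a) (i : Fin 3) : hS.ray i ≠ 0 :=
  fun h => hS.ray_ne_zero i (congrArg Subtype.val h)

/-- The monomials at the extremal rays form a system of parameters: they generate the maximal ideal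
up to radical. -/
theorem IsSimplicial.monomialIdeal_le_radical (hS : IsSimplicial S A a) {i j r : Fin 3}
    (hij : i ≠ j) (hir : i ≠ r) (hjr : j ≠ r) :
    monomialIdeal k S ≤ (Ideal.span {(single (hS.ray i) 1 : AddMonoidAlgebra k S),
      single (hS.ray j) 1, single (hS.ray r) 1}).radical := by
  refine Ideal.span_le.2 ?_
  rintro _ ⟨s, hs, rfl⟩
  obtain ⟨N, l, t, ht, hl⟩ := hS.exists_sle_nsmul s.2 (fun h => hs (Subtype.ext h))
  refine ⟨N, ?_⟩
  have h1 : N • s = ⟨t, ht⟩ + hS.ray l :=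
    Subtype.ext (by simpa [IsSimplicial.ray, add_comm] using hl)
  have h2 : (single s 1 : AddMonoidAlgebra k S) ^ N =
      single ⟨t, ht⟩ 1 * single (hS.ray l) 1 := by
    rw [single_pow, h1, single_mul_single, one_pow, one_mul]
  rw [h2]
  refine Ideal.mul_mem_left _ _ (Ideal.subset_span ?_)
  rcases eq_or_eq_or_eq hij hir hjr l with rfl | rfl | rfl <;> simp

/-- Vanishing of the first Koszul homology of the three rays gives the combinatorial
Cohen–Macaulay condition. An offending pair `(s, t)` gives a Koszul cycle supported at two of the
three rays; comparing coefficients in an expression of it as a boundary yields an offending pair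
whose first member is `s - a r`, where `r` is the third ray, and this cannot go on forever. -/
theorem IsSimplicial.exists_eq_add_of_koszulOneVanishes (hS : IsSimplicial S A a) {i j r : Fin 3}
    (h : KoszulOneVanishes (single (hS.ray i) 1 : AddMonoidAlgebra k S) (single (hS.ray j) 1)
      (single (hS.ray r) 1) (AddMonoidAlgebra k S)) {s t : S}
    (hst : hS.ray j + s = hS.ray i + t) : ∃ e, s = hS.ray i + e := by
  induction hk : ∑ l, (s : Fin 3 → ℕ) l using Nat.strong_induction_on generalizing s t with
  | _ n ih =>
  by_contra hno
  obtain ⟨p, q, w, -, hb, hc⟩ := h (single t 1) (-single s 1) 0 (by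
    simp only [smul_eq_mul, mul_neg, mul_zero, single_mul_single, hst]; simp)
  simp only [smul_eq_mul] at hb hc
  have h1 : (single (hS.ray r) 1 * w).coeff s = 1 := by
    have h2 : single (hS.ray r) 1 * w = single (hS.ray i) 1 * p + single s 1 := by
      linear_combination hb
    rw [h2, coeff_add, Finsupp.add_apply, coeff_single_mul_eq_zero p hno]
    simp
  have hr : ∃ s', s = hS.ray r + s' := by
    by_contra hr
    rw [coeff_single_mul_eq_zero w hr] at h1
    exact zero_ne_one h1
  obtain ⟨s', rfl⟩ := hr
  rw [coeff_single_mul_add] at h1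
  have hi : ∃ t', hS.ray j + s' = hS.ray i + t' := by
    by_contra hi
    have h2 := coeff_single_mul_eq_zero q hi
    have h3 := coeff_single_mul_add (hS.ray j) s' w
    have h4 : single (hS.ray j) 1 * w = -(single (hS.ray i) 1 * q) := by
      linear_combination -hc
    rw [h4, coeff_neg, Finsupp.neg_apply, h2, h1] at h3
    simp at h3
  obtain ⟨t', ht'⟩ := hi
  have hpos := sum_pos_of_ne_zero (hS.ray_ne_zero r)
  have hsum : ∑ l, ((hS.ray r + s' : S) : Fin 3 → ℕ) l =
      ∑ l, a r l + ∑ l, (s' : Fin 3 → ℕ) l := by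
    rw [← Finset.sum_add_distrib]; rfl
  obtain ⟨e, rfl⟩ := ih _ (by omega) ht' rfl
  exact hno ⟨hS.ray r + e, by abel⟩

theorem IsSimplicial.raysRegular_of_isWeaklyRegular (hS : IsSimplicial S A a)
    {f g h : AddMonoidAlgebra k S} {rs : List (AddMonoidAlgebra k S)}
    (hreg : IsWeaklyRegular (AddMonoidAlgebra k S) (f :: g :: h :: rs))
    (hf : f ∈ monomialIdeal k S) (hg : g ∈ monomialIdeal k S) (hh : h ∈ monomialIdeal k S) :
    RaysRegular S a := by
  intro i j hij s hs t ht hst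
  obtain ⟨r, hir, hjr⟩ := exists_third hij
  have hle := hS.monomialIdeal_le_radical (k := k) hij hir hjr
  have hK := koszulOneVanishes_of_isWeaklyRegular hreg (hle hf) (hle hg) (hle hh)
  refine sle_iff (b := hS.ray i) (x := ⟨s, hs⟩) |>.2
    (hS.exists_eq_add_of_koszulOneVanishes (t := ⟨t, ht⟩) hK (Subtype.ext ?_))
  rw [add_comm] at hst
  rw [add_comm t] at hst
  exact hst

theorem IsSimplicial.fg (hS : IsSimplicial S A a) : AddMonoid.FG S := by
  exact (AddMonoid.fg_iff_addSubmonoid_fg S).2 ⟨A, hS.closure_eq⟩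

/-- `k[S]` has depth at least two exactly when `Ap(S, b)` has no maximal element, for any fixed
nonzero `b` in `S`. -/
theorem IsSimplicial.two_le_depth_iff (hS : IsSimplicial S A a) {b : Fin 3 → ℕ} (hb : b ∈ S)
    (hb0 : b ≠ 0) : 2 ≤ depth k S ↔ ¬ HasMaximal S (apery S b) := by
  have := hS.fg
  constructor
  · intro h
    obtain ⟨_, ⟨rs, hreg, hm, rfl⟩, hlt⟩ :=
      lt_sSup_iff.1 (lt_of_lt_of_le (show (1 : ℕ∞) < 2 by decide) h)
    match rs, hreg, hm, hlt with
    | f :: g :: rs, hreg, hm, _ =>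
      exact not_hasMaximal_of_isWeaklyRegular hreg.1 (hm f (by simp)) (hm g (by simp)) hb
    | [_], _, _, hlt => simp at hlt
    | [], _, _, hlt => simp at hlt
  · intro h
    obtain ⟨g, hg, hreg⟩ := exists_isWeaklyRegular_of_not_hasMaximal (k := k) hb h
    refine le_depth hreg ?_
    simp only [List.mem_cons, List.not_mem_nil, or_false, forall_eq_or_imp, forall_eq]
    exact ⟨single_mem_monomialIdeal fun h => hb0 (congrArg Subtype.val h), hg⟩

/-- `k[S]` has depth at least three exactly when the combinatorial Cohen–Macaulay condition
holds. -/
theorem IsSimplicial.three_le_depth_iff (hS : IsSimplicial S A a) :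
    3 ≤ depth k S ↔ RaysRegular S a := by
  constructor
  · intro h
    obtain ⟨_, ⟨rs, hreg, hm, rfl⟩, hlt⟩ :=
      lt_sSup_iff.1 (lt_of_lt_of_le (show (2 : ℕ∞) < 3 by decide) h)
    match rs, hreg, hm, hlt with
    | f :: g :: e :: rs, hreg, hm, _ =>
      exact hS.raysRegular_of_isWeaklyRegular hreg.1 (hm f (by simp)) (hm g (by simp))
        (hm e (by simp))
    | [_, _], _, _, hlt => simp at hlt
    | [_], _, _, hlt => exact absurd (show (2 : ℕ∞) < (1 : ℕ) from hlt) (by decide)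
    | [], _, _, hlt => simp at hlt
  · intro h
    refine le_depth (h.isWeaklyRegular (k := k) hS) ?_
    simp only [List.mem_cons, List.not_mem_nil, or_false, forall_eq_or_imp, forall_eq]
    exact ⟨single_mem_monomialIdeal (hS.ray_ne_zero' 0), single_mem_monomialIdeal
      (hS.ray_ne_zero' 1), single_mem_monomialIdeal (hS.ray_ne_zero' 2)⟩

end Three
end AffineSemigroup

theorem theorem5p2 (k : Type*) [Field k] (S : AddSubmonoid (Fin 3 → ℕ))
    (A : Finset (Fin 3 → ℕ)) (a : Fin 3 → (Fin 3 → ℕ))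
    (hS : AffineSemigroup.IsSimplicial S A a) :
    ((∃ b ∈ S, b ≠ 0 ∧ ¬ AffineSemigroup.HasMaximal S (AffineSemigroup.apery S b)) ↔
      (∀ b ∈ S, b ≠ 0 → ¬ AffineSemigroup.HasMaximal S (AffineSemigroup.apery S b))) ∧
    (AffineSemigroup.depth k S = 2 ↔
      (∃ b ∈ S, b ≠ 0 ∧ ¬ AffineSemigroup.HasMaximal S (AffineSemigroup.apery S b)) ∧
      (∃ i j : Fin 3, i < j ∧ AffineSemigroup.HasMaximal S
        (AffineSemigroup.apery S (a i) ∩ AffineSemigroup.apery S (a j)))) := by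
  have hdepth : (∃ b ∈ S, b ≠ 0 ∧
      ¬ AffineSemigroup.HasMaximal S (AffineSemigroup.apery S b)) ↔
      2 ≤ AffineSemigroup.depth k S :=
    ⟨fun ⟨_, hb, hb0, h⟩ => (hS.two_le_depth_iff hb hb0).2 h, fun h =>
      ⟨a 0, hS.mem_semigroup 0, hS.ray_ne_zero 0,
        (hS.two_le_depth_iff (hS.mem_semigroup 0) (hS.ray_ne_zero 0)).1 h⟩⟩
  refine ⟨⟨fun h b hb hb0 => (hS.two_le_depth_iff hb hb0).1 (hdepth.1 h), fun h =>
    ⟨a 0, hS.mem_semigroup 0, hS.ray_ne_zero 0,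
      h _ (hS.mem_semigroup 0) (hS.ray_ne_zero 0)⟩⟩, ?_⟩
  rw [hdepth, hS.exists_hasMaximal_iff, ← hS.three_le_depth_iff (k := k), not_le]
  have h3 : (3 : ℕ∞) = 2 + 1 := by norm_num
  rw [h3, ENat.lt_add_one_iff (by simp), and_comm]
  exact le_antisymm_iff
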